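/- Let $N$ be a number of clones and $n=N+1$. Write $\psi^{+}=\frac{1}{\sqrt2}(|00\rangle+|11\rangle)$ and $\psi^{-}=\frac{1}{\sqrt2}(|01\rangle-|10\rangle)$, and for an $n$-qubit density operator $\rho$ let $\rho_{1k}$ be its reduced state on the qubits $1$ and $k$. A $1\to N$ qubit cloning machine is a completely positive trace-preserving map $\Lambda$ from operators on $\mathbb{C}^2$ to operators on $(\mathbb{C}^2)^{\otimes N}$. Its fidelity vector is $(F_{12},\dots,F_{1n})\in\mathbb{R}^N$ with $F_{1k}=\langle\psi^{+}|\rho_{1k}|\psi^{+}\rangle$, where $\rho=(\mathrm{id}\otimes\Lambda)(|\psi^{+}\rangle\langle\psi^{+}|)$ and qubit $1$ is the untouched half of $\psi^{+}$. Let $\mathcal{F}$ be the set of fidelity vectors of all such machines, and let $\mathcal{F}'$ be the set of vectors of singlet fractions $(\langle\psi^{-}|\rho_{1k}|\psi^{-}\rangle)_{k=2}^{n}$ of all $n$-qubit density operators $\rho$ whose first qubit is maximally mixed, i.e. $\rho_1=I/2$. Let $S_n$ act on $(\mathbb{C}^2)^{\otimes n}$ by permuting the tensor factors, and let $(V^\lambda)_\lambda$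 be any family of irreducible unitary representations $V^\lambda: S_n\to U(d_\lambda)$ such that every $V^\lambda$ is isomorphic to a subrepresentation of $(\mathbb{C}^2)^{\otimes n}$ and every irreducible unitary representation isomorphic to a subrepresentation of $(\mathbb{C}^2)^{\otimes n}$ is isomorphic to some $V^\lambda$. For each $\lambda$ put $$\mathcal{F}^\lambda=\Big\{\big(F^\lambda_{12},\dots,F^\lambda_{1n}\big)\;:\;F_{1k}^\lambda=\tfrac12-\tfrac12\langle\psi|V^\lambda_{(1k)}|\psi\rangle,\ \psi\in\mathbb{C}^{d_\lambda},\ \|\psi\|=1\Big\},$$ where $(1k)$ is the transposition of $1$ and $k$. Then $$\mathcal{F}=\mathcal{F}'=\operatorname{conv}\Big(\bigcup_\lambda\mathcal{F}^\lambda\Big).$$ -/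

import Mathlib

open scoped ComplexOrder Matrix

namespace QubitCloning

noncomputable section

/-! ### Vectors, states and reduced states -/

/-- The expectation value `⟨v|M|v⟩` (its real part; it is real whenever `M` is Hermitian). -/
def expval {α : Type*} [Fintype α] (v : α → ℂ) (M : Matrix α α ℂ) : ℝ :=
  (star v ⬝ᵥ (M *ᵥ v)).re

/-- The rank-one operator `|v⟩⟨v|`. -/
def ketBra {α : Type*} (v : α → ℂ) : Matrix α α ℂ :=
  Matrix.vecMulVec v (star v)

/-- The Bell vector `ψ⁺ = (|00⟩ + |11⟩) / √2` of two qubits. -/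
def psiPlus : Fin 2 × Fin 2 → ℂ :=
  ((Real.sqrt 2 : ℝ) : ℂ)⁻¹ • (Pi.single (0, 0) 1 + Pi.single (1, 1) 1)

/-- The singlet vector `ψ⁻ = (|01⟩ - |10⟩) / √2` of two qubits. -/
def psiMinus : Fin 2 × Fin 2 → ℂ :=
  ((Real.sqrt 2 : ℝ) : ℂ)⁻¹ • (Pi.single (0, 1) 1 - Pi.single (1, 0) 1)

/-- Computational basis labels of `n` qubits; operators on `(ℂ²)^{⊗ n}` are matrices
indexed by them. -/
abbrev Bits (n : ℕ) : Type := Fin n → Fin 2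

/-- A density operator: positive semidefinite with trace one. -/
def IsState {α : Type*} [Fintype α] (ρ : Matrix α α ℂ) : Prop :=
  ρ.PosSemidef ∧ ρ.trace = 1

/-- The reduced operator of the first qubit (all other qubits are traced out). -/
def reducedFirst {N : ℕ} (ρ : Matrix (Bits (N + 1)) (Bits (N + 1)) ℂ) :
    Matrix (Fin 2) (Fin 2) ℂ :=
  Matrix.of fun a b => ∑ x : Bits (N + 1),
    if x 0 = a then ρ x (Function.update x 0 b) else 0

/-- The reduced operator of the first qubit (index `0`) and the `k`-th of the remaining `N` qubits
(index `k.succ`); all other qubits are traced out. -/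
def reducedPair {N : ℕ} (ρ : Matrix (Bits (N + 1)) (Bits (N + 1)) ℂ) (k : Fin N) :
    Matrix (Fin 2 × Fin 2) (Fin 2 × Fin 2) ℂ :=
  Matrix.of fun p q => ∑ x : Bits (N + 1),
    if x 0 = p.1 ∧ x k.succ = p.2 then
      ρ x (Function.update (Function.update x 0 q.1) k.succ q.2)
    else 0

/-- The vector of overlaps with a two-qubit vector `φ` of the reduced states of the first qubit
and each of the other `N` qubits. -/
def overlaps {N : ℕ} (φ : Fin 2 × Fin 2 → ℂ)
    (ρ : Matrix (Bits (N + 1)) (Bits (N + 1)) ℂ) : Fin N → ℝ :=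
  fun k => expval φ (reducedPair ρ k)

/-! ### Cloning machines -/

/-- The map `id ⊗ Λ`, where the identity acts on operators on `ℂ^κ`. -/
def idTensor (κ : Type*) {α β : Type*} (Λ : Matrix α α ℂ →ₗ[ℂ] Matrix β β ℂ)
    (X : Matrix (κ × α) (κ × α) ℂ) : Matrix (κ × β) (κ × β) ℂ :=
  Matrix.of fun p q => Λ (Matrix.of fun s t => X (p.1, s) (q.1, t)) p.2 q.2

/-- Complete positivity: `id_m ⊗ Λ` preserves positivity for every `m`. -/
def IsCompletelyPositive {α β : Type*} (Λ : Matrix α α ℂ →ₗ[ℂ] Matrix β β ℂ) : Prop :=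
  ∀ (m : ℕ) (X : Matrix (Fin m × α) (Fin m × α) ℂ),
    X.PosSemidef → (idTensor (Fin m) Λ X).PosSemidef

/-- A `1 → N` qubit cloning machine: a completely positive trace preserving map from one qubit
to `N` qubits. -/
structure IsCloner {N : ℕ}
    (Λ : Matrix (Fin 2) (Fin 2) ℂ →ₗ[ℂ] Matrix (Bits N) (Bits N) ℂ) : Prop where
  completelyPositive : IsCompletelyPositive Λ
  tracePreserving : ∀ X, (Λ X).trace = X.trace

/-- The `(N + 1)`-qubit state `(id ⊗ Λ)(|ψ⁺⟩⟨ψ⁺|)`; qubit `0` is the untouched half of `ψ⁺`. -/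
def clonerState {N : ℕ} (Λ : Matrix (Fin 2) (Fin 2) ℂ →ₗ[ℂ] Matrix (Bits N) (Bits N) ℂ) :
    Matrix (Bits (N + 1)) (Bits (N + 1)) ℂ :=
  (idTensor (Fin 2) Λ (ketBra psiPlus)).submatrix
    (fun x => (x 0, Fin.tail x)) (fun x => (x 0, Fin.tail x))

/-- The fidelity vectors `(F₁₂, …, F₁ₙ)`, `n = N + 1`, of all `1 → N` cloning machines. -/
def clonerFidelities (N : ℕ) : Set (Fin N → ℝ) :=
  {F | ∃ Λ : Matrix (Fin 2) (Fin 2) ℂ →ₗ[ℂ] Matrix (Bits N) (Bits N) ℂ,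
    IsCloner Λ ∧ F = overlaps psiPlus (clonerState Λ)}

/-- The vectors `(F₁₂, …, F₁ₙ)`, `n = N + 1`, of singlet fractions of all `n`-qubit states whose
first qubit is maximally mixed. -/
def stateFidelities (N : ℕ) : Set (Fin N → ℝ) :=
  {F | ∃ ρ : Matrix (Bits (N + 1)) (Bits (N + 1)) ℂ,
    IsState ρ ∧ reducedFirst ρ = (2⁻¹ : ℂ) • 1 ∧ F = overlaps psiMinus ρ}

/-! ### Representations of the symmetric group -/

/-- A `d`-dimensional unitary representation of `S_n`, by matrices. -/
abbrev UnitaryRep (n d : ℕ) : Type :=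
  Equiv.Perm (Fin n) →* Matrix.unitaryGroup (Fin d) ℂ

/-- The representation on `ℂ^d` given by unitary matrices. -/
def UnitaryRep.toRep {n d : ℕ} (V : UnitaryRep n d) :
    Representation ℂ (Equiv.Perm (Fin n)) (Fin d → ℂ) where
  toFun g := Matrix.toLin' (V g : Matrix (Fin d) (Fin d) ℂ)
  map_one' := by simp; rfl
  map_mul' g h := by simp [Matrix.toLin'_mul]; rfl

/-- The representation of `S_n` on the qubit tensor space `(ℂ²)^{⊗ n}` permuting the tensor
factors: `π` sends the basis vector labelled `i` to the one labelled `i ∘ π⁻¹`. -/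
def tensorRep (n : ℕ) : Representation ℂ (Equiv.Perm (Fin n)) (Bits n → ℂ) where
  toFun g :=
    { toFun := fun f x => f (x ∘ g)
      map_add' := fun _ _ => rfl
      map_smul' := fun _ _ => rfl }
  map_one' := rfl
  map_mul' _ _ := rfl

/-- `V` occurs in the qubit tensor space: it is isomorphic to a subrepresentation. -/
def Occurs {n d : ℕ} (V : UnitaryRep n d) : Prop :=
  ∃ T : V.toRep.IntertwiningMap (tensorRep n), Function.Injective T

/-- A family of unitary irreps of `S_n` representing exactly the isomorphism classes of irreps that
occur in the qubit tensor space `(ℂ²)^{⊗ n}`: every member is irreducible and occurs, and every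
irrep that occurs is isomorphic to a member. -/
structure IsQubitIrrepSystem {n : ℕ} {ι : Type*} (d : ι → ℕ)
    (V : (i : ι) → UnitaryRep n (d i)) : Prop where
  irreducible : ∀ i, (V i).toRep.IsIrreducible
  occurs : ∀ i, Occurs (V i)
  exhaustive : ∀ (m : ℕ) (W : UnitaryRep n m), W.toRep.IsIrreducible → Occurs W →
    ∃ i, Nonempty (W.toRep.Equiv (V i).toRep)

/-- The set `𝓕^λ` of the representation `V = V^λ`: all vectors with entries
`1/2 - 1/2 ⟨ψ|V_{(1k)}|ψ⟩`, for unit vectors `ψ ∈ ℂ^d`. -/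
def irrepFidelities {N d : ℕ} (V : UnitaryRep (N + 1) d) : Set (Fin N → ℝ) :=
  {F | ∃ ψ : Fin d → ℂ, star ψ ⬝ᵥ ψ = 1 ∧
    ∀ k : Fin N, F k = 1 / 2 - 1 / 2 *
      expval ψ (V (Equiv.swap 0 k.succ) : Matrix (Fin d) (Fin d) ℂ)}

end

end QubitCloning

/-!
The singlet projector is `(1 - P) / 2`, with `P` the exchange of the two qubits, so the singlet
fractions of a state `ρ` are the numbers `½ - ½ tr(ρ P_{(0k)})` (`overlaps_psiMinus`): they depend on
`ρ` only through the action of the symmetric group on the tensor factors.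

*Cloning machines and states.* A cloning machine is determined by its Choi state, and the Choi states
are exactly the states whose first qubit is maximally mixed. Conjugating the first qubit by `i σ_y`
carries `ψ⁺` to `ψ⁻`, so `clonerFidelities_eq_stateFidelities`.

*The condition on the first qubit.* Averaging a state over the operators `σ ⊗ ⋯ ⊗ σ`, `σ` a Pauli
matrix, makes the first qubit maximally mixed. These operators commute with the permutations of the
qubits, so no singlet fraction changes (`IsState.overlaps_mem_stateFidelities`). Hence all states may
be used, which also makes the set of fidelity vectors convex.

*Decomposition into irreducibles.* Write `ρ = BᴴB`. Its singlet fractions are the sum over the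
conjugated rows `v` of `B` of the quadratic forms `½‖v‖² - ½⟨v|P_{(0k)}|v⟩`, and `∑ ‖v‖² = 1`. Each `v` is the sum of
its components in mutually orthogonal irreducible subspaces, between which the cross terms vanish
(`IsQubitIrrepSystem.exists_mem_convexHull_of_invariant`). On an irreducible subspace an isomorphism
with some `V l` is, by Schur's lemma, a multiple of an isometry
(`exists_pos_dotProduct_intertwiner`), so the component contributes a multiple of a vector of
`irrepFidelities (V l)`. The same lemma turns a unit vector of `ℂ^d` into a pure state of the qubits
with the same vector, which gives the other inclusion.
-/

namespace QubitCloning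

/-! ### Overlaps with the Bell vectors -/

theorem expval_psiMinus (M : Matrix (Fin 2 × Fin 2) (Fin 2 × Fin 2) ℂ) :
    expval psiMinus M =
      1 / 2 * (M (0, 1) (0, 1) - M (0, 1) (1, 0) - M (1, 0) (0, 1) + M (1, 0) (1, 0)).re := by
  have h2 : (Real.sqrt 2)⁻¹ * (Real.sqrt 2)⁻¹ = 1 / 2 := by
    rw [← mul_inv, Real.mul_self_sqrt (by norm_num)]; norm_num
  have hC : ((Real.sqrt 2 : ℝ) : ℂ)⁻¹ = ((Real.sqrt 2)⁻¹ : ℝ) := by push_cast; rfl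
  rw [expval, psiMinus, hC, star_smul, smul_dotProduct, Matrix.mulVec_smul, dotProduct_smul,
    smul_eq_mul, smul_eq_mul, Complex.star_def, Complex.conj_ofReal, ← mul_assoc,
    ← Complex.ofReal_mul, h2, Complex.re_ofReal_mul, star_sub, Matrix.mulVec_sub, sub_dotProduct,
    dotProduct_sub, dotProduct_sub, ← Pi.single_star, ← Pi.single_star]
  simp
  ring

theorem expval_psiPlus (M : Matrix (Fin 2 × Fin 2) (Fin 2 × Fin 2) ℂ) :
    expval psiPlus M =
      1 / 2 * (M (0, 0) (0, 0) + M (0, 0) (1, 1) + M (1, 1) (0, 0) + M (1, 1) (1, 1)).re := by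
  have h2 : (Real.sqrt 2)⁻¹ * (Real.sqrt 2)⁻¹ = 1 / 2 := by
    rw [← mul_inv, Real.mul_self_sqrt (by norm_num)]; norm_num
  have hC : ((Real.sqrt 2 : ℝ) : ℂ)⁻¹ = ((Real.sqrt 2)⁻¹ : ℝ) := by push_cast; rfl
  rw [expval, psiPlus, hC, star_smul, smul_dotProduct, Matrix.mulVec_smul, dotProduct_smul,
    smul_eq_mul, smul_eq_mul, Complex.star_def, Complex.conj_ofReal, ← mul_assoc,
    ← Complex.ofReal_mul, h2, Complex.re_ofReal_mul, star_add, Matrix.mulVec_add, add_dotProduct,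
    dotProduct_add, dotProduct_add, ← Pi.single_star, ← Pi.single_star]
  simp
  ring

/-- The singlet projector is `(1 - P) / 2`, where `P` exchanges the two qubits. -/
theorem overlaps_psiMinus {N : ℕ} (ρ : Matrix (Bits (N + 1)) (Bits (N + 1)) ℂ) (k : Fin N) :
    overlaps psiMinus ρ k =
      1 / 2 * ρ.trace.re - 1 / 2 * (∑ x, ρ x (x ∘ Equiv.swap 0 k.succ)).re := by
  rw [overlaps, expval_psiMinus, ← mul_sub, ← Complex.sub_re, Matrix.trace,
    ← Finset.sum_sub_distrib]
  simp only [reducedPair, Matrix.of_apply, ← Finset.sum_sub_distrib, ← Finset.sum_add_distrib]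
  congr 3 with x
  have hk : (0 : Fin (N + 1)) ≠ k.succ := (Fin.succ_ne_zero k).symm
  have hupd : ∀ a b : Fin 2, x 0 = b → x k.succ = a →
      Function.update (Function.update x 0 a) k.succ b = x ∘ Equiv.swap 0 k.succ := by
    rintro a b rfl rfl
    rw [Equiv.comp_swap_eq_update, Function.update_comm hk]
  have hself : ∀ a b : Fin 2, x 0 = a → x k.succ = b →
      Function.update (Function.update x 0 a) k.succ b = x := by
    rintro a b rfl rfl
    simp
  have hswap : ∀ a, x 0 = a → x k.succ = a → x ∘ Equiv.swap 0 k.succ = x := fun a h h' => by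
    rw [← hupd a a h h', hself a a h h']
  have hcases : ∀ b : Fin 2, b = 0 ∨ b = 1 := by decide
  rcases hcases (x 0) with h | h <;> rcases hcases (x k.succ) with h' | h'
  · simp [h, h', hswap 0 h h']
  · simp [h, h', hself 0 1 h h', hupd 1 0 h h']
  · simp [h, h', hself 1 0 h h', hupd 0 1 h h']
    ring
  · simp [h, h', hswap 1 h h']

/-! ### The flip exchanging the two Bell vectors -/

/-- The bit string with its first bit flipped. -/
def flipFirst {N : ℕ} (x : Bits (N + 1)) : Bits (N + 1) := Function.update x 0 (x 0 + 1)

/-- The sign `(-1) ^ b`. -/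
def bitSign (b : Fin 2) : ℂ := (-1) ^ (b : ℕ)

theorem flipFirst_flipFirst {N : ℕ} (x : Bits (N + 1)) : flipFirst (flipFirst x) = x := by
  have : x 0 + 1 + 1 = x 0 := by generalize x 0 = b; revert b; decide
  simp [flipFirst, this]

/-- Conjugation of the first qubit by `i σ_y`, which maps `ψ⁺` to `ψ⁻` and preserves `I / 2`. -/
noncomputable def conjFirst {N : ℕ} (ρ : Matrix (Bits (N + 1)) (Bits (N + 1)) ℂ) :
    Matrix (Bits (N + 1)) (Bits (N + 1)) ℂ :=
  Matrix.of fun x y => bitSign (x 0) * bitSign (y 0) * ρ (flipFirst x) (flipFirst y)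

/-- Reindexing along any `f`, then conjugation by a real diagonal matrix, preserves positivity; this
serves both for the flip of the first qubit and for the Pauli twirl. -/
theorem posSemidef_conj_sign {α : Type*} [Fintype α] [DecidableEq α] {ρ : Matrix α α ℂ}
    (h : ρ.PosSemidef) (s : α → ℂ) (f : α → α) (hs : ∀ x, star (s x) = s x) :
    (Matrix.of fun x y => s x * s y * ρ (f x) (f y)).PosSemidef := by
  convert (h.submatrix f).conjTranspose_mul_mul_same (Matrix.diagonal s) using 1
  ext x y
  rw [Matrix.diagonal_conjTranspose, Matrix.mul_diagonal, Matrix.diagonal_mul]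
  simp only [Matrix.of_apply, Matrix.submatrix_apply, Pi.star_apply, hs]
  ring

theorem star_bitSign (b : Fin 2) : star (bitSign b) = bitSign b := by simp [bitSign]

theorem bitSign_mul_self (b : Fin 2) : bitSign b * bitSign b = 1 := by
  rw [bitSign, ← mul_pow]; simp

/-- The flip of the first bit, as a permutation of the bit strings. -/
def flipFirstEquiv (N : ℕ) : Equiv.Perm (Bits (N + 1)) :=
  ⟨flipFirst, flipFirst, flipFirst_flipFirst, flipFirst_flipFirst⟩

theorem trace_conjFirst {N : ℕ} (ρ : Matrix (Bits (N + 1)) (Bits (N + 1)) ℂ) :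
    (conjFirst ρ).trace = ρ.trace :=
  Fintype.sum_equiv (flipFirstEquiv N) _ _ fun x => by
    simp [conjFirst, bitSign_mul_self, flipFirstEquiv]

theorem IsState.conjFirst {N : ℕ} {ρ : Matrix (Bits (N + 1)) (Bits (N + 1)) ℂ} (h : IsState ρ) :
    IsState (conjFirst ρ) :=
  ⟨posSemidef_conj_sign h.1 (fun x => bitSign (x 0)) flipFirst fun _ => star_bitSign _,
    (trace_conjFirst ρ).trans h.2⟩

theorem conjFirst_conjFirst {N : ℕ} (ρ : Matrix (Bits (N + 1)) (Bits (N + 1)) ℂ) :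
    conjFirst (conjFirst ρ) = ρ := by
  have h : ∀ b : Fin 2, bitSign b * bitSign (b + 1) = -1 := by
    intro b; fin_cases b <;> simp [bitSign]
  ext x y
  simp only [conjFirst, Matrix.of_apply, flipFirst_flipFirst]
  simp only [flipFirst, Function.update_self]
  linear_combination (ρ x y) * (bitSign (y 0) * bitSign (y 0 + 1)) * h (x 0) - ρ x y * h (y 0)

theorem reducedFirst_conjFirst {N : ℕ} (ρ : Matrix (Bits (N + 1)) (Bits (N + 1)) ℂ) (a b : Fin 2) :
    reducedFirst (conjFirst ρ) a b = bitSign a * bitSign b * reducedFirst ρ (a + 1) (b + 1) := by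
  simp only [reducedFirst, Matrix.of_apply, Finset.mul_sum]
  refine Fintype.sum_equiv (flipFirstEquiv N) _ _ fun x => ?_
  by_cases h : x 0 = a
  · subst h
    simp [conjFirst, flipFirstEquiv, flipFirst]
  · simp [h, flipFirstEquiv, flipFirst]

theorem reducedPair_conjFirst {N : ℕ} (ρ : Matrix (Bits (N + 1)) (Bits (N + 1)) ℂ) (k : Fin N)
    (p q : Fin 2 × Fin 2) :
    reducedPair (conjFirst ρ) k p q =
      bitSign p.1 * bitSign q.1 * reducedPair ρ k (p.1 + 1, p.2) (q.1 + 1, q.2) := by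
  have hk : (0 : Fin (N + 1)) ≠ k.succ := (Fin.succ_ne_zero k).symm
  simp only [reducedPair, Matrix.of_apply, Finset.mul_sum]
  refine Fintype.sum_equiv (flipFirstEquiv N) _ _ fun x => ?_
  by_cases h : x 0 = p.1
  · by_cases h' : x k.succ = p.2
    · simp [h, h', conjFirst, flipFirstEquiv, flipFirst, hk.symm,
        Function.update_comm hk]
    · simp [h', flipFirstEquiv, flipFirst, hk.symm]
  · simp [h, flipFirstEquiv, flipFirst]

theorem overlaps_psiMinus_conjFirst {N : ℕ} (ρ : Matrix (Bits (N + 1)) (Bits (N + 1)) ℂ) :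
    overlaps psiMinus (conjFirst ρ) = overlaps psiPlus ρ := by
  ext k
  rw [overlaps, overlaps, expval_psiMinus, expval_psiPlus]
  simp only [reducedPair_conjFirst]
  simp [bitSign]
  ring

theorem reducedFirst_conjFirst_of_maximallyMixed {N : ℕ}
    {ρ : Matrix (Bits (N + 1)) (Bits (N + 1)) ℂ} (h : reducedFirst ρ = (2⁻¹ : ℂ) • 1) :
    reducedFirst (conjFirst ρ) = (2⁻¹ : ℂ) • 1 := by
  ext a b
  rw [reducedFirst_conjFirst, h]
  fin_cases a <;> fin_cases b <;> simp [bitSign]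

/-! ### Cloning machines and their Choi states -/

theorem reducedFirst_eq_sum_cons {N : ℕ} (ρ : Matrix (Bits (N + 1)) (Bits (N + 1)) ℂ)
    (a b : Fin 2) :
    reducedFirst ρ a b = ∑ s : Bits N, ρ (Fin.cons a s : Bits (N + 1)) (Fin.cons b s) := by
  rw [reducedFirst, Matrix.of_apply,
    ← (Fin.consEquiv (fun _ : Fin (N + 1) => Fin 2)).sum_comp, Fintype.sum_prod_type,
    Finset.sum_eq_single a]
  · simp [Fin.consEquiv, Fin.update_cons_zero]
  · intro c _ hc
    simp [Fin.consEquiv, hc]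
  · simp

theorem trace_reducedFirst {N : ℕ} (ρ : Matrix (Bits (N + 1)) (Bits (N + 1)) ℂ) :
    (reducedFirst ρ).trace = ρ.trace := by
  simp only [Matrix.trace, Matrix.diag, reducedFirst_eq_sum_cons]
  rw [← (Fin.consEquiv (fun _ : Fin (N + 1) => Fin 2)).sum_comp, Fintype.sum_prod_type]
  rfl

theorem psiPlus_apply (a b : Fin 2) :
    psiPlus (a, b) = if a = b then ((Real.sqrt 2 : ℝ) : ℂ)⁻¹ else 0 := by
  fin_cases a <;> fin_cases b <;> simp [psiPlus]

theorem clonerState_apply {N : ℕ} (Λ : Matrix (Fin 2) (Fin 2) ℂ →ₗ[ℂ] Matrix (Bits N) (Bits N) ℂ)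
    (x y : Bits (N + 1)) :
    clonerState Λ x y =
      2⁻¹ * Λ (Matrix.single (x 0) (y 0) 1) (Fin.tail x) (Fin.tail y) := by
  have h2 : ((Real.sqrt 2 : ℝ) : ℂ)⁻¹ * ((Real.sqrt 2 : ℝ) : ℂ)⁻¹ = 2⁻¹ := by
    rw [← mul_inv, ← Complex.ofReal_mul, Real.mul_self_sqrt (by norm_num)]; norm_num
  have h : (Matrix.of fun s t => ketBra psiPlus (x 0, s) (y 0, t)) =
      (2⁻¹ : ℂ) • Matrix.single (x 0) (y 0) 1 := by
    ext s t
    simp only [ketBra, Matrix.of_apply, Matrix.vecMulVec_apply, Pi.star_apply, psiPlus_apply,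
      Matrix.smul_apply, Matrix.single_apply, smul_eq_mul]
    by_cases h1 : x 0 = s <;> by_cases h3 : y 0 = t <;> simp [h1, h3, h2]
  rw [clonerState, Matrix.submatrix_apply, idTensor, Matrix.of_apply, h, map_smul]
  rfl

/-- The Choi state of a cloning machine is a state with maximally mixed first qubit. -/
theorem IsCloner.clonerState {N : ℕ}
    {Λ : Matrix (Fin 2) (Fin 2) ℂ →ₗ[ℂ] Matrix (Bits N) (Bits N) ℂ} (h : IsCloner Λ) :
    IsState (clonerState Λ) ∧ reducedFirst (QubitCloning.clonerState Λ) = (2⁻¹ : ℂ) • 1 := by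
  have hred : reducedFirst (QubitCloning.clonerState Λ) = (2⁻¹ : ℂ) • 1 := by
    ext a b
    have := h.tracePreserving (Matrix.single a b 1)
    rw [Matrix.trace] at this
    simp only [reducedFirst_eq_sum_cons, clonerState_apply, Fin.cons_zero, Fin.tail_cons,
      ← Finset.mul_sum]
    simp only [Matrix.diag] at this
    rw [this, Matrix.smul_apply, smul_eq_mul]
    congr 1
    by_cases hab : a = b
    · subst hab; simp
    · simp [hab]
  refine ⟨⟨(h.completelyPositive 2 _ (Matrix.posSemidef_vecMulVec_self_star _)).submatrix _, ?_⟩,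
    hred⟩
  rw [← trace_reducedFirst, hred]
  simp [Matrix.trace]

/-- Every state with maximally mixed first qubit is the Choi state of a cloning machine, namely of
`X ↦ 2 ∑ a b, X a b • ρ (a ·) (b ·)`. -/
theorem exists_isCloner_clonerState_eq {N : ℕ} {ρ : Matrix (Bits (N + 1)) (Bits (N + 1)) ℂ}
    (hρ : ρ.PosSemidef) (hred : reducedFirst ρ = (2⁻¹ : ℂ) • 1) :
    ∃ Λ : Matrix (Fin 2) (Fin 2) ℂ →ₗ[ℂ] Matrix (Bits N) (Bits N) ℂ,
      IsCloner Λ ∧ clonerState Λ = ρ := by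
  let Λ : Matrix (Fin 2) (Fin 2) ℂ →ₗ[ℂ] Matrix (Bits N) (Bits N) ℂ :=
    { toFun := fun X => Matrix.of fun s t => 2 * ∑ a, ∑ b,
        X a b * ρ (Fin.cons a s : Bits (N + 1)) (Fin.cons b t)
      map_add' := fun X Y => by
        ext s t
        simp only [Matrix.of_apply, Matrix.add_apply, add_mul, Finset.sum_add_distrib, mul_add]
      map_smul' := fun c X => by
        ext s t
        simp only [Matrix.of_apply, Matrix.smul_apply, smul_eq_mul, Finset.mul_sum,
          RingHom.id_apply]
        refine Finset.sum_congr rfl fun a _ => Finset.sum_congr rfl fun b _ => ?_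
        ring }
  have hΛ : ∀ X s t, Λ X s t = 2 * ∑ a, ∑ b,
      X a b * ρ (Fin.cons a s : Bits (N + 1)) (Fin.cons b t) := fun _ _ _ => rfl
  refine ⟨Λ, ⟨fun m X hX => ?_, fun X => ?_⟩, ?_⟩
  · -- `id ⊗ Λ` applied to `X` is a compression of `X ⊗ ρ`: both copies of the input qubit are
    -- contracted against each other.
    let C : Matrix ((Fin m × Fin 2) × Bits (N + 1)) (Fin m × Bits N) ℂ :=
      Matrix.of fun i p => if i.1.1 = p.1 ∧ i.2 = Fin.cons i.1.2 p.2 then 1 else 0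
    have h := ((hX.kronecker hρ).conjTranspose_mul_mul_same C).smul (zero_le_two (α := ℂ))
    suffices heq : idTensor (Fin m) Λ X = (2 : ℂ) • (Cᴴ * Matrix.kroneckerMap (· * ·) X ρ * C) by
      rw [heq]
      exact h
    ext p q
    have hC : ∀ (f : (Fin m × Fin 2) × Bits (N + 1) → ℂ) p,
        ∑ i, C i p * f i = ∑ a, f ((p.1, a), Fin.cons a p.2) := fun f p => by
      simp [C, Fintype.sum_prod_type, ite_and]
    have hCs : ∀ i p, star (C i p) = C i p := fun i p => by
      simp only [C, Matrix.of_apply]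
      split_ifs <;> simp
    change Λ _ p.2 q.2 = _
    rw [hΛ, Matrix.smul_apply, Matrix.mul_assoc, Matrix.mul_apply]
    simp only [Matrix.conjTranspose_apply, hCs, hC, Matrix.mul_apply]
    simp only [mul_comm _ (C _ _), hC, Matrix.kroneckerMap_apply, Matrix.of_apply, smul_eq_mul]
  · have h : (Λ X).trace = 2 * ∑ a, ∑ b, X a b * reducedFirst ρ a b := by
      simp only [Matrix.trace, Matrix.diag, hΛ, reducedFirst_eq_sum_cons, ← Finset.mul_sum]
      congr 1
      rw [Finset.sum_comm]
      refine Finset.sum_congr rfl fun a _ => ?_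
      rw [Finset.sum_comm]
      simp only [Finset.mul_sum]
    rw [h, hred]
    simp [Matrix.trace, Matrix.one_apply]
    ring
  · ext x y
    rw [clonerState_apply, hΛ, Finset.sum_eq_single (x 0), Finset.sum_eq_single (y 0)]
    · rw [Matrix.single_apply_same, Fin.cons_self_tail, Fin.cons_self_tail]
      ring
    · intro b _ hb
      simp [hb.symm]
    · simp
    · intro a _ ha
      simp [ha.symm]
    · simp

/-- Cloning fidelities are singlet fractions: the Choi correspondence followed by the flip of the
untouched qubit. -/
theorem clonerFidelities_eq_stateFidelities (N : ℕ) : clonerFidelities N = stateFidelities N := by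
  ext F
  constructor
  · rintro ⟨Λ, hΛ, rfl⟩
    obtain ⟨hs, hr⟩ := hΛ.clonerState
    exact ⟨_, hs.conjFirst, reducedFirst_conjFirst_of_maximallyMixed hr,
      (overlaps_psiMinus_conjFirst _).symm⟩
  · rintro ⟨ρ, hρ, hr, rfl⟩
    obtain ⟨Λ, hΛ, h⟩ := exists_isCloner_clonerState_eq hρ.conjFirst.1
      (reducedFirst_conjFirst_of_maximallyMixed hr)
    exact ⟨Λ, hΛ, by rw [h, ← overlaps_psiMinus_conjFirst, conjFirst_conjFirst]⟩

/-! ### The Pauli twirl -/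

/-- The sign `(-1) ^ (x₀ + ⋯ + x_N)`. -/
noncomputable def paritySign {n : ℕ} (x : Bits n) : ℂ := ∏ i, bitSign (x i)

/-- The average of `ρ` over conjugation by `σ ⊗ ⋯ ⊗ σ` for the four Pauli matrices `σ`: the index
`c` of `σ = Z ^ e X ^ c` shifts the bit strings, and `e` is the exponent of the sign. -/
noncomputable def pauliTwirl {n : ℕ} (ρ : Matrix (Bits n) (Bits n) ℂ) :
    Matrix (Bits n) (Bits n) ℂ :=
  (4⁻¹ : ℂ) • ∑ c : Fin 2, ∑ e : Fin 2, Matrix.of fun x y =>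
    paritySign x ^ (e : ℕ) * paritySign y ^ (e : ℕ) * ρ (fun i => x i + c) (fun i => y i + c)

theorem star_paritySign {n : ℕ} (x : Bits n) : star (paritySign x) = paritySign x := by
  simp only [paritySign, star_prod, star_bitSign]

theorem paritySign_mul_self {n : ℕ} (x : Bits n) : paritySign x * paritySign x = 1 := by
  rw [paritySign, ← Finset.prod_mul_distrib]
  exact Finset.prod_eq_one fun i _ => bitSign_mul_self _

theorem paritySign_comp_perm {n : ℕ} (x : Bits n) (g : Equiv.Perm (Fin n)) :
    paritySign (x ∘ g) = paritySign x :=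
  Equiv.prod_comp g fun i => bitSign (x i)

theorem pauliTwirl_apply {n : ℕ} (ρ : Matrix (Bits n) (Bits n) ℂ) (x y : Bits n) :
    pauliTwirl ρ x y = 4⁻¹ * (1 + paritySign x * paritySign y) *
      ∑ c : Fin 2, ρ (fun i => x i + c) (fun i => y i + c) := by
  simp [pauliTwirl]
  ring

theorem sum_shift {n : ℕ} (c : Fin 2) (f : Bits n → ℂ) :
    ∑ x : Bits n, f (fun i => x i + c) = ∑ x, f x :=
  Equiv.sum_comp (Equiv.addRight fun _ : Fin n => c) f

/-- The twirl does not change the expectation values of the permutations of the qubits. -/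
theorem sum_pauliTwirl_comp_perm {n : ℕ} (ρ : Matrix (Bits n) (Bits n) ℂ)
    (g : Equiv.Perm (Fin n)) : ∑ x, pauliTwirl ρ x (x ∘ g) = ∑ x, ρ x (x ∘ g) := by
  simp only [pauliTwirl_apply, paritySign_comp_perm, paritySign_mul_self, ← Finset.mul_sum]
  rw [Finset.sum_comm]
  have h : ∀ c : Fin 2, ∑ x : Bits n, ρ (fun i => x i + c) (fun i => (x ∘ g) i + c) =
      ∑ x, ρ x (x ∘ g) := fun c => sum_shift c fun x => ρ x (x ∘ g)
  simp only [h]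
  simp
  ring

theorem trace_pauliTwirl {n : ℕ} (ρ : Matrix (Bits n) (Bits n) ℂ) :
    (pauliTwirl ρ).trace = ρ.trace :=
  sum_pauliTwirl_comp_perm ρ 1

theorem IsState.pauliTwirl {n : ℕ} {ρ : Matrix (Bits n) (Bits n) ℂ} (h : IsState ρ) :
    IsState (pauliTwirl ρ) := by
  refine ⟨Matrix.PosSemidef.smul ?_ (by norm_num [Complex.nonneg_iff]),
    (trace_pauliTwirl ρ).trans h.2⟩
  refine Matrix.posSemidef_sum _ fun c _ => Matrix.posSemidef_sum _ fun e _ => ?_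
  exact posSemidef_conj_sign h.1 (fun x => paritySign x ^ (e : ℕ)) _ fun x => by
    rw [star_pow, star_paritySign]

/-- After the twirl the reduced state of the first qubit commutes with the Pauli matrices, hence is
maximally mixed. -/
theorem reducedFirst_pauliTwirl {N : ℕ} {ρ : Matrix (Bits (N + 1)) (Bits (N + 1)) ℂ}
    (h : ρ.trace = 1) : reducedFirst (pauliTwirl ρ) = (2⁻¹ : ℂ) • 1 := by
  have hsign : ∀ (a : Fin 2) (s : Bits N),
      paritySign (Fin.cons a s : Bits (N + 1)) = bitSign a * paritySign s := fun a s => by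
    simp [paritySign, Fin.prod_univ_succ]
  have hdiag : ∀ a, reducedFirst (pauliTwirl ρ) a a = 2⁻¹ := fun a => by
    rw [reducedFirst_eq_sum_cons]
    simp only [pauliTwirl_apply, paritySign_mul_self, ← Finset.mul_sum]
    have hc : ∀ (c : Fin 2) (s : Bits N), (fun i => (Fin.cons a s : Bits (N + 1)) i + c) =
        (Fin.cons (a + c) (fun i => s i + c) : Bits (N + 1)) := fun c s => by
      ext i
      refine Fin.cases ?_ (fun j => ?_) i <;> simp
    simp only [hc]
    rw [Finset.sum_comm]
    have h2 : ∀ c : Fin 2, ∑ s : Bits N, ρ (Fin.cons (a + c) (fun i => s i + c) : Bits (N + 1))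
        (Fin.cons (a + c) (fun i => s i + c)) = reducedFirst ρ (a + c) (a + c) := fun c => by
      rw [reducedFirst_eq_sum_cons]
      exact sum_shift c fun s => ρ (Fin.cons (a + c) s : Bits (N + 1)) (Fin.cons (a + c) s)
    simp only [h2]
    have h3 := Equiv.sum_comp (Equiv.addLeft a) fun b => reducedFirst ρ b b
    simp only [Equiv.coe_addLeft] at h3
    have h4 : ∑ b, reducedFirst ρ b b = 1 := (trace_reducedFirst ρ).trans h
    rw [h3, h4]
    norm_num
  have hoff : ∀ a b, a ≠ b → reducedFirst (pauliTwirl ρ) a b = 0 := fun a b hab => by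
    rw [reducedFirst_eq_sum_cons]
    refine Finset.sum_eq_zero fun s _ => ?_
    have : bitSign a * bitSign b = -1 := by
      fin_cases a <;> fin_cases b <;> simp_all [bitSign]
    rw [pauliTwirl_apply, hsign, hsign]
    have h0 : 1 + bitSign a * paritySign s * (bitSign b * paritySign s) = 0 := by
      linear_combination (paritySign s * paritySign s) * this - paritySign_mul_self s
    rw [h0, mul_zero, zero_mul]
  ext a b
  by_cases hab : a = b
  · subst hab
    simp [hdiag]
  · simp [hab, hoff a b hab]

/-- By the Pauli twirl, the condition on the first qubit may be dropped. -/
theorem IsState.overlaps_mem_stateFidelities {N : ℕ}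
    {ρ : Matrix (Bits (N + 1)) (Bits (N + 1)) ℂ} (h : IsState ρ) :
    overlaps psiMinus ρ ∈ stateFidelities N := by
  refine ⟨_, h.pauliTwirl, reducedFirst_pauliTwirl h.2, funext fun k => ?_⟩
  rw [overlaps_psiMinus, overlaps_psiMinus, trace_pauliTwirl, sum_pauliTwirl_comp_perm]

/-! ### Invariant subspaces of the qubit tensor space -/

theorem dotProduct_tensorRep {n : ℕ} (g : Equiv.Perm (Fin n)) (v w : Bits n → ℂ) :
    star (tensorRep n g v) ⬝ᵥ tensorRep n g w = star v ⬝ᵥ w :=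
  Fintype.sum_equiv (g.arrowCongr (Equiv.refl (Fin 2))).symm _ _ fun _ => rfl

theorem dotProduct_tensorRep_right {n : ℕ} (g : Equiv.Perm (Fin n)) (v w : Bits n → ℂ) :
    star v ⬝ᵥ tensorRep n g w = star (tensorRep n g⁻¹ v) ⬝ᵥ w := by
  rw [← dotProduct_tensorRep g (tensorRep n g⁻¹ v) w, ← Module.End.mul_apply, ← map_mul]
  simp

theorem toRep_apply {n d : ℕ} (V : UnitaryRep n d) (g : Equiv.Perm (Fin n)) (x : Fin d → ℂ) :
    V.toRep g x = (V g : Matrix (Fin d) (Fin d) ℂ) *ᵥ x := rfl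

/-- Schur's lemma for unitary representations: an injective intertwiner from an irreducible
unitary representation is a positive multiple of an isometry, because `T† T` commutes with the
representation and hence is a scalar. -/
theorem exists_pos_dotProduct_intertwiner {n d : ℕ} (V : UnitaryRep n d)
    (hV : V.toRep.IsIrreducible) (T : V.toRep.IntertwiningMap (tensorRep n))
    (hT : Function.Injective T) :
    ∃ c : ℝ, 0 < c ∧ ∀ x y, star (T x) ⬝ᵥ T y = c * (star x ⬝ᵥ y) := by
  set M : Matrix (Bits n) (Fin d) ℂ := LinearMap.toMatrix' T.toLinearMap with hM
  have hMT : ∀ x, M *ᵥ x = T x := fun x => by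
    rw [hM, LinearMap.toMatrix'_mulVec]; rfl
  have hdot : ∀ x y, star (T x) ⬝ᵥ T y = star x ⬝ᵥ ((Mᴴ * M) *ᵥ y) := fun x y => by
    rw [← hMT, ← hMT, Matrix.star_mulVec, ← Matrix.dotProduct_mulVec, Matrix.mulVec_mulVec]
  have hUV : ∀ g x y, star (V.toRep g x) ⬝ᵥ V.toRep g y = star x ⬝ᵥ y := fun g x y => by
    have h := (Matrix.mem_unitaryGroup_iff').mp (V g).2
    rw [Matrix.star_eq_conjTranspose] at h
    rw [toRep_apply, toRep_apply, Matrix.star_mulVec, ← Matrix.dotProduct_mulVec,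
      Matrix.mulVec_mulVec, h, Matrix.one_mulVec]
  have hcomm : ∀ g x, Matrix.toLin' (Mᴴ * M) (V.toRep g x) =
      V.toRep g (Matrix.toLin' (Mᴴ * M) x) := fun g x => by
    refine dotProduct_eq _ _ fun w => ?_
    obtain ⟨z, rfl⟩ : ∃ z, w = star (V.toRep g z) := by
      refine ⟨V.toRep g⁻¹ (star w), ?_⟩
      rw [← Module.End.mul_apply, ← map_mul]
      simp
    rw [dotProduct_comm, dotProduct_comm _ (star _), hUV, Matrix.toLin'_apply,
      Matrix.toLin'_apply, ← hdot, ← hdot, T.isIntertwining, T.isIntertwining,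
      dotProduct_tensorRep]
  have := hV
  obtain ⟨c, hc⟩ :=
    (Representation.IsIrreducible.algebraMap_intertwiningMap_bijective_of_isAlgClosed
      (ρ := V.toRep)).2
      ((Matrix.toLin' (Mᴴ * M)).intertwiningMap_of_isIntertwiningMap _ _ hcomm)
  have hc' : ∀ y, (Mᴴ * M) *ᵥ y = c • y := fun y => (congrArg (fun f => f y) hc).symm
  have key : ∀ x y, star (T x) ⬝ᵥ T y = c * (star x ⬝ᵥ y) := fun x y => by
    rw [hdot, hc', dotProduct_smul, smul_eq_mul]
  obtain ⟨x, hx⟩ : ∃ x : Fin d → ℂ, x ≠ 0 := by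
    obtain ⟨S, hS⟩ := exists_ne (⊥ : Subrepresentation V.toRep)
    by_contra! h
    refine hS (Subrepresentation.toSubmodule_injective ((Submodule.eq_bot_iff _).2 fun x _ => h x))
  have hTx : T x ≠ 0 := fun h => hx (hT (h.trans (map_zero T).symm))
  have h1 : 0 < star (T x) ⬝ᵥ T x := Matrix.dotProduct_star_self_pos_iff.2 hTx
  have h2 : 0 < star x ⬝ᵥ x := Matrix.dotProduct_star_self_pos_iff.2 hx
  rw [key] at h1
  have h3 : 0 < c := pos_of_mul_pos_left h1 h2.le
  obtain ⟨h4, h5⟩ := Complex.pos_iff.1 h3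
  refine ⟨c.re, h4, fun x y => ?_⟩
  rw [key]
  congr 1
  exact Complex.ext rfl h5.symm

/-- A subspace has an orthonormal basis; it is recorded by the matrix `B` of its columns. -/
theorem exists_orthonormal_columns {α : Type*} [Fintype α] [DecidableEq α]
    (W : Submodule ℂ (α → ℂ)) :
    ∃ (m : ℕ) (B : Matrix α (Fin m) ℂ), Bᴴ * B = 1 ∧ (∀ x, B *ᵥ x ∈ W) ∧
      ∀ v ∈ W, B *ᵥ (Bᴴ *ᵥ v) = v := by
  let e := WithLp.linearEquiv 2 ℂ (α → ℂ)
  let W' : Submodule ℂ (EuclideanSpace ℂ α) := W.comap e.toLinearMap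
  let b := stdOrthonormalBasis ℂ W'
  let B : Matrix α (Fin (Module.finrank ℂ W')) ℂ := Matrix.of fun a j => (b j : EuclideanSpace ℂ α) a
  have hB : ∀ x, B *ᵥ x = e (∑ j, x j • (b j : EuclideanSpace ℂ α)) := fun x => by
    ext a
    simp [B, e, Matrix.mulVec, dotProduct, mul_comm]
  refine ⟨_, B, ?_, fun x => ?_, fun v hv => ?_⟩
  · ext i j
    have := orthonormal_iff_ite.1 b.orthonormal i j
    rw [Submodule.coe_inner] at this
    rw [Matrix.one_apply, ← this, Matrix.mul_apply]
    simp [B, PiLp.inner_apply, mul_comm]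
  · rw [hB]
    exact W'.sum_mem fun j _ => W'.smul_mem _ (b j).2
  · have h := congrArg (fun w : W' => e (w : EuclideanSpace ℂ α))
      (b.sum_repr' ⟨e.symm v, by simpa [W'] using hv⟩)
    rw [hB]
    convert h using 2
    · rw [Submodule.coe_sum]
      refine Finset.sum_congr rfl fun j _ => ?_
      rw [Submodule.coe_smul, Submodule.coe_inner]
      congr 1
      simp [B, Matrix.mulVec, dotProduct, PiLp.inner_apply, e, mul_comm]
    · exact (e.apply_symm_apply v).symm

/-- The representation of `S_n` on an invariant subspace, in an orthonormal basis given by the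
columns of `B`. -/
theorem exists_unitaryRep_of_columns {n m : ℕ} (B : Matrix (Bits n) (Fin m) ℂ) (hB : Bᴴ * B = 1)
    (hinv : ∀ g x, B *ᵥ (Bᴴ *ᵥ tensorRep n g (B *ᵥ x)) = tensorRep n g (B *ᵥ x)) :
    ∃ V : UnitaryRep n m, ∀ g x, B *ᵥ V.toRep g x = tensorRep n g (B *ᵥ x) := by
  let A : Equiv.Perm (Fin n) → Matrix (Fin m) (Fin m) ℂ :=
    fun g => Bᴴ * LinearMap.toMatrix' (tensorRep n g) * B
  have hA : ∀ g x, A g *ᵥ x = Bᴴ *ᵥ tensorRep n g (B *ᵥ x) := fun g x => by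
    simp only [A, ← Matrix.mulVec_mulVec, LinearMap.toMatrix'_mulVec]
  have hBA : ∀ g x, B *ᵥ (A g *ᵥ x) = tensorRep n g (B *ᵥ x) := fun g x => by rw [hA, hinv]
  have hBB : ∀ x, Bᴴ *ᵥ (B *ᵥ x) = x := fun x => by
    rw [Matrix.mulVec_mulVec, hB, Matrix.one_mulVec]
  have hdot : ∀ x y, star (B *ᵥ x) ⬝ᵥ (B *ᵥ y) = star x ⬝ᵥ y := fun x y => by
    rw [Matrix.star_mulVec, ← Matrix.dotProduct_mulVec, hBB]
  have hone : A 1 = 1 := Matrix.ext_of_mulVec_single fun i => by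
    rw [hA, map_one, Module.End.one_apply, hBB, Matrix.one_mulVec]
  have hmul : ∀ g h, A (g * h) = A g * A h := fun g h => Matrix.ext_of_mulVec_single fun i => by
    rw [hA, ← Matrix.mulVec_mulVec, hA g, hBA, map_mul, Module.End.mul_apply]
  have hunit : ∀ g, A g ∈ Matrix.unitaryGroup (Fin m) ℂ := fun g => by
    rw [Matrix.mem_unitaryGroup_iff', Matrix.star_eq_conjTranspose]
    refine Matrix.ext_of_mulVec_single fun i => dotProduct_eq _ _ fun w => ?_
    have := dotProduct_tensorRep g (B *ᵥ star w) (B *ᵥ Pi.single i 1)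
    rw [← hBA, ← hBA, hdot, hdot, Matrix.star_mulVec, ← Matrix.dotProduct_mulVec, star_star,
      Matrix.mulVec_mulVec] at this
    rw [dotProduct_comm, this, dotProduct_comm, Matrix.one_mulVec]
  exact ⟨{ toFun := fun g => ⟨A g, hunit g⟩
           map_one' := Subtype.ext hone
           map_mul' := fun g h => Subtype.ext (hmul g h) }, hBA⟩

/-- The vector of the numbers `½‖v‖² - ½⟨v|P_{(0k)}|v⟩`, a quadratic form in `v`; for a unit vector
these are the singlet fractions of `|v⟩⟨v|`. -/
noncomputable def swapVector {N : ℕ} (v : Bits (N + 1) → ℂ) : Fin N → ℝ :=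
  fun k => 1 / 2 * (star v ⬝ᵥ v).re -
    1 / 2 * (star v ⬝ᵥ tensorRep (N + 1) (Equiv.swap 0 k.succ) v).re

/-- If `V` embeds by `T`, its fidelity vectors are the normalised `swapVector`s of the range
of `T`. -/
theorem exists_mem_irrepFidelities {N d : ℕ} (V : UnitaryRep (N + 1) d)
    (hV : V.toRep.IsIrreducible) (T : V.toRep.IntertwiningMap (tensorRep (N + 1)))
    (hT : Function.Injective T) {x : Fin d → ℂ} (hx : x ≠ 0) :
    ∃ F ∈ irrepFidelities V, swapVector (T x) = (star (T x) ⬝ᵥ T x).re • F := by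
  obtain ⟨c, -, hc⟩ := exists_pos_dotProduct_intertwiner V hV T hT
  set r := (star x ⬝ᵥ x).re with hr
  obtain ⟨hr0, hri⟩ := Complex.pos_iff.1 (Matrix.dotProduct_star_self_pos_iff.2 hx)
  have hrx : star x ⬝ᵥ x = (r : ℂ) := Complex.ext rfl hri.symm
  set s : ℝ := (Real.sqrt r)⁻¹ with hs
  have hss : s * s * r = 1 := by
    rw [hs, ← mul_inv, Real.mul_self_sqrt hr0.le, inv_mul_cancel₀ hr0.ne']
  refine ⟨_, ⟨(s : ℂ) • x, ?_, fun k => rfl⟩, ?_⟩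
  · rw [star_smul, smul_dotProduct, dotProduct_smul, hrx]
    simp only [smul_eq_mul, Complex.star_def, Complex.conj_ofReal]
    rw [← mul_assoc]
    exact_mod_cast hss
  · ext k
    have h1 : (star (T x) ⬝ᵥ T x).re = c * r := by
      rw [hc, hrx]; simp
    simp only [swapVector, ← T.isIntertwining, Pi.smul_apply, smul_eq_mul, expval,
      Matrix.mulVec_smul, star_smul, smul_dotProduct, dotProduct_smul, Complex.star_def,
      Complex.conj_ofReal, hc, toRep_apply, Complex.re_ofReal_mul]
    linear_combination (1 / 2 * c * (star x ⬝ᵥ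
      (V (Equiv.swap 0 k.succ) : Matrix (Fin d) (Fin d) ℂ) *ᵥ x).re) * hss

/-- Every fidelity vector of an occurring irreducible representation is that of a pure state of the
qubits: a rescaled intertwiner is an isometry into the tensor space. -/
theorem exists_unit_of_mem_irrepFidelities {N d : ℕ} (V : UnitaryRep (N + 1) d)
    (hV : V.toRep.IsIrreducible) (hocc : Occurs V) {F : Fin N → ℝ} (hF : F ∈ irrepFidelities V) :
    ∃ v : Bits (N + 1) → ℂ, star v ⬝ᵥ v = 1 ∧ swapVector v = F := by
  obtain ⟨T, hT⟩ := hocc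
  obtain ⟨c, hc0, hc⟩ := exists_pos_dotProduct_intertwiner V hV T hT
  obtain ⟨x, hx, hxF⟩ := hF
  set s : ℝ := (Real.sqrt c)⁻¹ with hs
  have hss : s * s * c = 1 := by
    rw [hs, ← mul_inv, Real.mul_self_sqrt hc0.le, inv_mul_cancel₀ hc0.ne']
  have hssC : (s : ℂ) * (s * c) = 1 := by rw [← mul_assoc]; exact_mod_cast hss
  have key : ∀ y, star ((s : ℂ) • T x) ⬝ᵥ ((s : ℂ) • T y) = star x ⬝ᵥ y := fun y => by
    rw [star_smul, smul_dotProduct, dotProduct_smul, hc]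
    simp only [smul_eq_mul, Complex.star_def, Complex.conj_ofReal]
    rw [← mul_assoc (s : ℂ) c, ← mul_assoc, hssC, one_mul]
  refine ⟨(s : ℂ) • T x, (key x).trans hx, funext fun k => ?_⟩
  rw [hxF, swapVector, key, hx, map_smul, ← T.isIntertwining, key, toRep_apply, expval]
  simp

/-- A minimal invariant subspace is the range of an embedding of some member of the system. -/
theorem IsQubitIrrepSystem.exists_intertwiner_of_minimal {n : ℕ} {ι : Type*} {d : ι → ℕ}
    {V : (l : ι) → UnitaryRep n (d l)} (hV : IsQubitIrrepSystem d V)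
    (W : Submodule ℂ (Bits n → ℂ)) (hW : ∀ g, ∀ v ∈ W, tensorRep n g v ∈ W) (hne : W ≠ ⊥)
    (hmin : ∀ W' ≤ W, (∀ g, ∀ v ∈ W', tensorRep n g v ∈ W') → W' = ⊥ ∨ W' = W) :
    ∃ (l : ι) (T : (V l).toRep.IntertwiningMap (tensorRep n)), Function.Injective T ∧
      ∀ v ∈ W, ∃ x, T x = v := by
  obtain ⟨m, B, hB, hBW, hWB⟩ := exists_orthonormal_columns W
  obtain ⟨R, hR⟩ := exists_unitaryRep_of_columns B hB fun g x => hWB _ (hW g _ (hBW x))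
  have hinj : Function.Injective (B *ᵥ ·) := fun x y h => by
    have := congrArg (Bᴴ *ᵥ ·) h
    simpa [Matrix.mulVec_mulVec, hB] using this
  let T : R.toRep.IntertwiningMap (tensorRep n) :=
    (Matrix.toLin' B).intertwiningMap_of_isIntertwiningMap _ _ hR
  have hT : ∀ x, T x = B *ᵥ x := fun _ => rfl
  have hTinj : Function.Injective T := hinj
  have hsub : ∀ S : Subrepresentation R.toRep, S = ⊥ ∨ S = ⊤ := fun S => by
    have hS : S.toSubmodule.map (Matrix.toLin' B) ≤ W := by
      rintro _ ⟨x, -, rfl⟩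
      exact hBW x
    have hSg : ∀ g, ∀ v ∈ S.toSubmodule.map (Matrix.toLin' B),
        tensorRep n g v ∈ S.toSubmodule.map (Matrix.toLin' B) := by
      rintro g _ ⟨x, hx, rfl⟩
      exact ⟨_, S.apply_mem_toSubmodule g hx, hR g x⟩
    rcases hmin _ hS hSg with h | h
    · left
      refine Subrepresentation.toSubmodule_injective ((Submodule.eq_bot_iff _).2 fun x hx => ?_)
      have h0 : B *ᵥ x ∈ S.toSubmodule.map (Matrix.toLin' B) := ⟨x, hx, rfl⟩
      rw [h, Submodule.mem_bot] at h0
      exact hinj (h0.trans (Matrix.mulVec_zero B).symm)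
    · right
      refine Subrepresentation.toSubmodule_injective (Submodule.eq_top_iff'.2 fun x => ?_)
      obtain ⟨y, hy, hyx⟩ : B *ᵥ x ∈ S.toSubmodule.map (Matrix.toLin' B) := h ▸ hBW x
      exact hinj hyx ▸ hy
  have hnt : Nontrivial (Subrepresentation R.toRep) := by
    obtain ⟨v, hv, hv0⟩ := W.ne_bot_iff.1 hne
    refine ⟨⊥, ⊤, fun h => hv0 ?_⟩
    have : Bᴴ *ᵥ v ∈ (⊥ : Subrepresentation R.toRep) := h ▸ Submodule.mem_top
    rw [← hWB v hv, (Submodule.mem_bot ℂ).1 this, Matrix.mulVec_zero]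
  obtain ⟨l, ⟨e⟩⟩ := hV.exhaustive m R { eq_bot_or_eq_top := hsub } ⟨T, hTinj⟩
  refine ⟨l, T.comp e.symm.toIntertwiningMap, hTinj.comp e.symm.toLinearEquiv.injective,
    fun v hv => ⟨e (Bᴴ *ᵥ v), ?_⟩⟩
  refine (congrArg T (e.symm_apply_apply _)).trans ?_
  exact hWB v hv

theorem dotProduct_add_of_orthogonal {α : Type*} [Fintype α] {v w v' w' : α → ℂ}
    (h : star v ⬝ᵥ w' = 0) (h' : star w ⬝ᵥ v' = 0) :
    star (v + w) ⬝ᵥ (v' + w') = star v ⬝ᵥ v' + star w ⬝ᵥ w' := by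
  rw [star_add, add_dotProduct, dotProduct_add, dotProduct_add, h, h', add_zero, zero_add]

/-- Complete reducibility, in the form needed here: splitting an invariant subspace into orthogonal
invariant pieces until they are minimal exhibits `swapVector v` as `‖v‖²` times a convex
combination of fidelity vectors of irreducible representations. -/
theorem IsQubitIrrepSystem.exists_mem_convexHull_of_invariant {N : ℕ} {ι : Type*} {d : ι → ℕ}
    {V : (l : ι) → UnitaryRep (N + 1) (d l)} (hV : IsQubitIrrepSystem d V) (r : ℕ) :
    ∀ W : Submodule ℂ (Bits (N + 1) → ℂ), Module.finrank ℂ W = r → W ≠ ⊥ →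
      (∀ g, ∀ v ∈ W, tensorRep (N + 1) g v ∈ W) → ∀ v ∈ W,
      ∃ p ∈ convexHull ℝ (⋃ l, irrepFidelities (V l)),
        swapVector v = (star v ⬝ᵥ v).re • p := by
  induction r using Nat.strong_induction_on with
  | _ r ih =>
  intro W hr hne hW v hv
  by_cases hmin : ∀ W' ≤ W, (∀ g, ∀ v ∈ W', tensorRep (N + 1) g v ∈ W') → W' = ⊥ ∨ W' = W
  · obtain ⟨l, T, hT, hTW⟩ := hV.exists_intertwiner_of_minimal W hW hne hmin
    -- The vector `v` may vanish; any fidelity vector then serves, and one exists as `W ≠ ⊥`.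
    obtain ⟨w, hw, hw0, hvw⟩ : ∃ w ∈ W, w ≠ 0 ∧ (v ≠ 0 → v = w) := by
      by_cases hv0 : v = 0
      · obtain ⟨w, hw, hw0⟩ := W.ne_bot_iff.1 hne
        exact ⟨w, hw, hw0, fun h => (h hv0).elim⟩
      · exact ⟨v, hv, hv0, fun _ => rfl⟩
    obtain ⟨x, rfl⟩ := hTW w hw
    obtain ⟨F, hF, hFx⟩ := exists_mem_irrepFidelities (V l) (hV.irreducible l) T hT
      (x := x) (fun h => hw0 (by rw [h, map_zero]))
    refine ⟨F, subset_convexHull ℝ _ (Set.mem_iUnion.2 ⟨l, hF⟩), ?_⟩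
    by_cases hv0 : v = 0
    · ext k
      simp [hv0, swapVector]
    · rw [hvw hv0, hFx]
  · push Not at hmin
    obtain ⟨W₁, hle, hW₁, hne₁, hneW⟩ := hmin
    obtain ⟨m, B, hB, hBW, hWB⟩ := exists_orthonormal_columns W₁
    let W₂ : Submodule ℂ (Bits (N + 1) → ℂ) :=
      { carrier := {u | u ∈ W ∧ ∀ w ∈ W₁, star w ⬝ᵥ u = 0}
        zero_mem' := ⟨W.zero_mem, fun _ _ => dotProduct_zero _⟩
        add_mem' := fun ha hb => ⟨W.add_mem ha.1 hb.1, fun w hw => by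
          rw [dotProduct_add, ha.2 w hw, hb.2 w hw, add_zero]⟩
        smul_mem' := fun c u hu => ⟨W.smul_mem c hu.1, fun w hw => by
          rw [dotProduct_smul, hu.2 w hw, smul_zero]⟩ }
    have hle₂ : W₂ ≤ W := fun u hu => hu.1
    have hW₂ : ∀ g, ∀ u ∈ W₂, tensorRep (N + 1) g u ∈ W₂ := fun g u hu =>
      ⟨hW g u hu.1, fun w hw => by rw [dotProduct_tensorRep_right, hu.2 _ (hW₁ _ _ hw)]⟩
    have hsplit : ∀ u ∈ W, u - B *ᵥ (Bᴴ *ᵥ u) ∈ W₂ := fun u hu => by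
      refine ⟨W.sub_mem hu (hle (hBW _)), fun w hw => ?_⟩
      rw [← hWB w hw, Matrix.star_mulVec, ← Matrix.dotProduct_mulVec, Matrix.mulVec_sub,
        Matrix.mulVec_mulVec _ Bᴴ B, hB, Matrix.one_mulVec, sub_self, dotProduct_zero]
    have hne₂ : W₂ ≠ ⊥ := fun h => by
      refine hneW (le_antisymm hle fun u hu => ?_)
      have := hsplit u hu
      rw [h, Submodule.mem_bot, sub_eq_zero] at this
      rw [this]
      exact hBW _
    have hneW₂ : W₂ ≠ W := fun h => by
      obtain ⟨w, hw, hw0⟩ := W₁.ne_bot_iff.1 hne₁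
      have h2 : w ∈ W₂ := h ▸ hle hw
      exact hw0 (dotProduct_star_self_eq_zero.1 (h2.2 w hw))
    obtain ⟨p₁, hp₁, h₁⟩ := ih _ (hr ▸ Submodule.finrank_lt_finrank_of_lt
      (lt_of_le_of_ne hle hneW)) W₁ rfl hne₁ hW₁ (B *ᵥ (Bᴴ *ᵥ v)) (hBW _)
    obtain ⟨p₂, hp₂, h₂⟩ := ih _ (hr ▸ Submodule.finrank_lt_finrank_of_lt
      (lt_of_le_of_ne hle₂ hneW₂)) W₂ rfl hne₂ hW₂ _ (hsplit v hv)
    set a := B *ᵥ (Bᴴ *ᵥ v) with ha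
    set b := v - a with hb
    have haW : a ∈ W₁ := hBW _
    have hbW : b ∈ W₂ := hsplit v hv
    have hvab : v = a + b := by rw [hb, add_sub_cancel]
    have horth : ∀ x ∈ W₁, ∀ y ∈ W₂, star x ⬝ᵥ y = 0 ∧ star y ⬝ᵥ x = 0 := fun x hx y hy =>
      ⟨hy.2 x hx, by rw [← star_star (star y ⬝ᵥ x), ← Matrix.star_dotProduct, hy.2 x hx, star_zero]⟩
    obtain ⟨p, hp, h⟩ := (convex_convexHull ℝ _).exists_mem_add_smul_eq hp₁ hp₂
      (p := (star a ⬝ᵥ a).re) (q := (star b ⬝ᵥ b).re)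
      (Complex.nonneg_iff.1 (dotProduct_star_self_nonneg a)).1
      (Complex.nonneg_iff.1 (dotProduct_star_self_nonneg b)).1
    have hadd : swapVector (a + b) = swapVector a + swapVector b := by
      ext k
      simp only [swapVector, Pi.add_apply, map_add]
      rw [dotProduct_add_of_orthogonal (horth a haW b hbW).1 (horth a haW b hbW).2,
        dotProduct_add_of_orthogonal (horth a haW _ (hW₂ _ b hbW)).1
          (horth _ (hW₁ _ a haW) b hbW).2, Complex.add_re, Complex.add_re]
      ring
    refine ⟨p, hp, ?_⟩
    rw [hvab, hadd, h₁, h₂, dotProduct_add_of_orthogonal (horth a haW b hbW).1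
      (horth a haW b hbW).2, Complex.add_re, h]

/-! ### The convex hull -/

theorem convex_stateFidelities (N : ℕ) : Convex ℝ (stateFidelities N) := by
  rintro _ ⟨ρ, hρ, -, rfl⟩ _ ⟨σ, hσ, -, rfl⟩ a b ha hb hab
  have habC : (a : ℂ) + b = 1 := by exact_mod_cast hab
  have hs : IsState ((a : ℂ) • ρ + (b : ℂ) • σ) := by
    refine ⟨(hρ.1.smul (by exact_mod_cast ha)).add (hσ.1.smul (by exact_mod_cast hb)), ?_⟩
    rw [Matrix.trace_add, Matrix.trace_smul, Matrix.trace_smul, hρ.2, hσ.2, smul_eq_mul,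
      smul_eq_mul, mul_one, mul_one, habC]
  convert hs.overlaps_mem_stateFidelities using 1
  ext k
  simp only [Pi.add_apply, Pi.smul_apply, smul_eq_mul, overlaps_psiMinus, Matrix.add_apply,
    Matrix.smul_apply, Finset.sum_add_distrib, ← Finset.mul_sum, Matrix.trace_add,
    Matrix.trace_smul, Complex.add_re, Complex.re_ofReal_mul]
  ring

theorem posSemidef_ketBra {α : Type*} [Fintype α] (v : α → ℂ) : (ketBra v).PosSemidef :=
  Matrix.posSemidef_vecMulVec_self_star v

theorem trace_ketBra {α : Type*} [Fintype α] (v : α → ℂ) : (ketBra v).trace = star v ⬝ᵥ v := by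
  rw [ketBra, Matrix.trace_vecMulVec, dotProduct_comm]

theorem overlaps_psiMinus_ketBra {N : ℕ} (v : Bits (N + 1) → ℂ) :
    overlaps psiMinus (ketBra v) = swapVector v := by
  ext k
  rw [overlaps_psiMinus, trace_ketBra, swapVector, dotProduct_tensorRep_right, Equiv.swap_inv,
    dotProduct_comm (star (tensorRep _ _ _))]
  rfl

theorem overlaps_psiMinus_conjTranspose_mul {N : ℕ} {α : Type*} [Fintype α]
    (B : Matrix α (Bits (N + 1)) ℂ) :
    overlaps psiMinus (Bᴴ * B) = ∑ i, swapVector (star (B i)) := by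
  have h : ∀ x y, (Bᴴ * B) x y = ∑ i, ketBra (star (B i)) x y := fun x y => by
    simp [Matrix.mul_apply, ketBra, Matrix.vecMulVec_apply]
  have hsum : ∀ f : Bits (N + 1) → Bits (N + 1), (∑ x, (Bᴴ * B) x (f x)).re =
      ∑ i, (∑ x, ketBra (star (B i)) x (f x)).re := fun f => by
    simp only [h]
    rw [Finset.sum_comm, Complex.re_sum]
  ext k
  simp only [← overlaps_psiMinus_ketBra, Finset.sum_apply, overlaps_psiMinus,
    Finset.sum_sub_distrib, ← Finset.mul_sum, ← hsum]
  rw [Matrix.trace]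
  simp only [Matrix.trace, Matrix.diag, ← hsum fun x => x]

theorem stateFidelities_eq_convexHull {N : ℕ} {ι : Type*} {d : ι → ℕ}
    {V : (l : ι) → UnitaryRep (N + 1) (d l)} (hV : IsQubitIrrepSystem d V) :
    stateFidelities N = convexHull ℝ (⋃ l, irrepFidelities (V l)) := by
  refine Set.Subset.antisymm ?_ (convexHull_min ?_ (convex_stateFidelities N))
  · rintro _ ⟨ρ, hρ, -, rfl⟩
    obtain ⟨B, rfl⟩ : ∃ B : Matrix (Bits (N + 1)) (Bits (N + 1)) ℂ, ρ = Bᴴ * B := by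
      open scoped MatrixOrder in
      exact CStarAlgebra.nonneg_iff_eq_star_mul_self.mp hρ.1.nonneg
    have hne : (⊤ : Submodule ℂ (Bits (N + 1) → ℂ)) ≠ ⊥ := top_ne_bot
    choose p hp hpv using fun v : Bits (N + 1) → ℂ =>
      hV.exists_mem_convexHull_of_invariant _ ⊤ rfl hne (fun _ _ _ => Submodule.mem_top) v
        Submodule.mem_top
    rw [overlaps_psiMinus_conjTranspose_mul]
    simp only [hpv]
    refine (convex_convexHull ℝ _).sum_mem
      (fun i _ => (Complex.nonneg_iff.1 (dotProduct_star_self_nonneg _)).1) ?_ fun i _ => hp _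
    rw [← Complex.re_sum]
    have := congrArg Complex.re hρ.2
    rw [Complex.one_re, Matrix.trace_mul_comm] at this
    rw [← this]
    congr 1
    refine Finset.sum_congr rfl fun i _ => ?_
    rw [star_star]
    rfl
  · refine Set.iUnion_subset fun l F hF => ?_
    obtain ⟨v, hv, rfl⟩ :=
      exists_unit_of_mem_irrepFidelities (V l) (hV.irreducible l) (hV.occurs l) hF
    rw [← overlaps_psiMinus_ketBra]
    exact IsState.overlaps_mem_stateFidelities ⟨posSemidef_ketBra v, (trace_ketBra v).trans hv⟩

end QubitCloning

theorem theorem1 (N : ℕ) {ι : Type*} (d : ι → ℕ)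
    (V : (l : ι) → QubitCloning.UnitaryRep (N + 1) (d l))
    (hV : QubitCloning.IsQubitIrrepSystem d V) :
    QubitCloning.clonerFidelities N =
        convexHull ℝ (⋃ l, QubitCloning.irrepFidelities (V l)) ∧
      QubitCloning.stateFidelities N =
        convexHull ℝ (⋃ l, QubitCloning.irrepFidelities (V l)) := by
  have h := QubitCloning.stateFidelities_eq_convexHull hV
  exact ⟨(QubitCloning.clonerFidelities_eq_stateFidelities N).trans h, h⟩
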